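/- Let $\Omega=\{q\in\mathbb R^2:\|q\|<1\}$ and let $b$ be a magnetic field that is locally Lipschitz on an open neighbourhood $U$ of $\overline\Omega$ and radial on the disc, $b(q)=B(\|q\|)$ for $\|q\|\le 1$. A trajectory is a solution of Newton's equation $\ddot q_1=b(q)\,\dot q_2$, $\ddot q_2=-b(q)\,\dot q_1$. Consider the trajectory starting at time $0$ at a point $q(0)$ with $\|q(0)\|=1$, with velocity $\dot q(0)=v_1\neq 0$, and let $v_r=\langle q(0),v_1\rangle$ and $v_\theta=\det(q(0),v_1)$ be the radial and tangential components of $v_1$. Assume that it enters $\Omega$, in the sense that either $v_r<0$, or $v_r=0$ and $B(1)/v_\theta<-1$. Put \[ G(r)=\int_0^r\tau B(\tau)\,d\tau,\qquad p_\theta=v_\theta+G(1),\qquad H_0=\tfrac12\|v_1\|^2,\qquad V(r)=\frac{(p_\theta-G(r))^2}{2r^2}\quad(r>0), \] and let $\gamma$ be the oriented angle from the outward normal $q(0)$ to $v_1$. Assume that (i) either the equation $V(r)=H_0$ has a solution in $(0,1)$ and the solution $r^*$ in $(0,1)$ closest to $1$ satisfies $V'(r^*)<0$, (ii) or $p_\theta=0$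 and the equation $V(r)=H_0$ has no solution in $(0,1)$. Then the trajectory escapes from $\Omega$ in finite time: it exists, and is the unique trajectory with its initial data, on an interval $[0,T]$ with $0<T<\infty$, where $\|q(t)\|<1$ for $0<t<T$ and $\|q(T)\|=1$, and the straight half-line $q(T)+s v_2$, $s>0$, with $v_2=\dot q(T)$, does not meet $\overline\Omega$. Moreover $\|v_2\|=\|v_1\|$, and the oriented angle $\omega\in(-\pi,\pi]$ from $v_1$ to $v_2$ is given modulo $2\pi$ as follows. In case (i) the trajectory does not pass through the origin during $[0,T]$, and \[ \omega\equiv\alpha+\pi-2\gamma,\qquad \alpha=2\int_{r^*}^1\frac{p_\theta-G(r)}{r\sqrt{2H_0r^2-(p_\theta-G(r))^2}}\,dr . \] In case (ii) the trajectory passes through the origin during $(0,T)$, and \[ \omega\equiv\alpha-2\gamma,\qquad \alpha=2\int_0^1\frac{-G(r)}{r\sqrt{2H_0r^2-G(r)^2}}\,dr . \] In both cases the integral converges absolutely. -/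

import Mathlib

noncomputable section

namespace MagneticScattering

/-- `(q, v)` is a solution on `[0, T]`, with position `q` in `U`, of Newton's equation
`q'' = q' × (0, 0, b(q))`, that is `q₁'' = b(q) q₂'`, `q₂'' = -b(q) q₁'`, where the plane is
identified with `ℂ`, so that the Lorentz force is `-i b(q) q'`. -/
structure IsTrajectoryOn (b : ℂ → ℝ) (U : Set ℂ) (T : ℝ) (q v : ℝ → ℂ) : Prop where
  mem : ∀ t ∈ Set.Icc 0 T, q t ∈ U
  velocity : ∀ t ∈ Set.Icc 0 T, HasDerivWithinAt q (v t) (Set.Icc 0 T) t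
  newton : ∀ t ∈ Set.Icc 0 T,
    HasDerivWithinAt v (-Complex.I * (b (q t) : ℂ) * v t) (Set.Icc 0 T) t

/-- Radial component of the velocity `v` at the point `q ≠ 0`. -/
def radialVelocity (q v : ℂ) : ℝ := (starRingEnd ℂ q * v).re / ‖q‖

/-- Tangential (counterclockwise) component of the velocity `v` at the point `q ≠ 0`. -/
def tangentialVelocity (q v : ℂ) : ℝ := (starRingEnd ℂ q * v).im / ‖q‖

/-- `G(r) = ∫₀ʳ τ B(τ) dτ`. -/
def G (B : ℝ → ℝ) (r : ℝ) : ℝ := ∫ τ in (0 : ℝ)..r, τ * B τ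

/-- The canonical angular momentum `p_θ = r v_θ + G(r)`. -/
def angularMomentum (B : ℝ → ℝ) (q v : ℂ) : ℝ :=
  ‖q‖ * tangentialVelocity q v + G B ‖q‖

/-- The energy `H₀ = ‖v‖² / 2`. -/
def energy (v : ℂ) : ℝ := ‖v‖ ^ 2 / 2

/-- The effective radial potential `V(r) = (p_θ - G(r))² / (2 r²)`. -/
def V (B : ℝ → ℝ) (p : ℝ) (r : ℝ) : ℝ := (p - G B r) ^ 2 / (2 * r ^ 2)

/-- `r` is the solution of `V = H₀` in `(0, 1)` that is closest to `1`. -/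
def IsOutermostTurningPoint (B : ℝ → ℝ) (p H₀ r : ℝ) : Prop :=
  IsGreatest {r : ℝ | r ∈ Set.Ioo (0 : ℝ) 1 ∧ V B p r = H₀} r

/-- The integrand `(p_θ - G(r)) / (r √(2 H₀ r² - (p_θ - G(r))²))`. -/
def angleIntegrand (B : ℝ → ℝ) (p H₀ r : ℝ) : ℝ :=
  (p - G B r) / (r * Real.sqrt (2 * H₀ * r ^ 2 - (p - G B r) ^ 2))

/-- The curve `q`, with velocity `v`, crosses the open unit disc during `(0, T)` and is at time
`T` on the unit circle; the free (straight) motion that continues it outside the disc never meets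
the closed disc again. -/
structure EscapesAt (q v : ℝ → ℂ) (T : ℝ) : Prop where
  pos : 0 < T
  inside : ∀ t ∈ Set.Ioo 0 T, ‖q t‖ < 1
  boundary : ‖q T‖ = 1
  leaves : ∀ s : ℝ, 0 < s → 1 < ‖q T + s * v T‖

/-- The oriented angle from `w` to `z`, with value in `(-π, π]`. -/
def orientedAngle (w z : ℂ) : ℝ := Complex.arg (starRingEnd ℂ w * z)

end MagneticScattering

end

open Set Filter Topology MeasureTheory
open scoped NNReal ComplexConjugate

namespace MagneticScattering

/-! Write u = ‖q‖², conj q · v = w + i l, s = ‖v₁‖ and g(r²) = G(r) (`fluxSq`). The speed s and the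
angular momentum p = l + g(u) are conserved, so the radial motion is one-dimensional: u' = 2w, w' =
D(u), w² = P(u), with P(x) = s²x − (p − g(x))² and D = P'. These variables stay differentiable at
the origin, so both cases are treated alike, with a = r*² in case (i) and a = 0 in case (ii): P(a) =
0 < D(a), and P has no zero in (a, 1).

Since D(a) ≠ 0, the value u = a is reached at a finite time τ (`exists_fall_time`). There w = 0, so
time reversal about τ combined with reflection in the line through 0 orthogonal to v(τ) preserves
the trajectory (`IsPhaseSolution.reflection`). The exit time is T = 2τ, and the exit velocity is
determined by v₁ and v(τ)².

The latter follows from the swept angle ∫ κ dt, where l = κ u (`velocity_sq_eq`). The substitution r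
= √u turns this angle into α/2 and gives absolute convergence (`integral_radius_eq_integral_time`).
There remains a real factor s² − 2lκ at time τ: it is −s² in case (i), where l² = s²a, and s² in
case (ii), where l = 0. This sign is the π by which the two formulas differ. -/

/-! ### Existence and uniqueness for the differential equations. -/

/-- A bounded, globally Lipschitz vector field has global integral curves. -/
theorem exists_global_solution {E : Type*} [NormedAddCommGroup E] [NormedSpace ℝ E]
    [CompleteSpace E] {F : E → E} {K M : ℝ≥0} (hF : LipschitzWith K F) (hM : ∀ x, ‖F x‖ ≤ M)
    (x₀ : E) : ∃ f : ℝ → E, f 0 = x₀ ∧ ∀ t, HasDerivAt f (F (f t)) t := by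
  have key : ∀ n : ℕ, ∃ f : ℝ → E, f 0 = x₀ ∧
      ∀ t ∈ Ioo (-(n + 1 : ℝ)) (n + 1), HasDerivAt f (F (f t)) t := by
    intro n
    have hmem : (0 : ℝ) ∈ Icc (-(n + 1 : ℝ)) (n + 1) := ⟨by linarith [n.cast_nonneg (α := ℝ)],
      by positivity⟩
    have hPL : IsPicardLindelof (fun _ ↦ F) (⟨0, hmem⟩ : Icc (-(n + 1 : ℝ)) (n + 1)) x₀
        (M * (n + 1)) 0 M K :=
      IsPicardLindelof.of_time_independent (fun x _ ↦ hM x) hF.lipschitzOnWith (by simp)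
    obtain ⟨f, hf₀, hf⟩ := hPL.exists_eq_forall_mem_Icc_hasDerivWithinAt₀
    exact ⟨f, hf₀, fun t ht ↦ (hf t (Ioo_subset_Icc_self ht)).hasDerivAt (Icc_mem_nhds ht.1 ht.2)⟩
  choose f hf₀ hf using key
  have agree : ∀ m n : ℕ, m ≤ n → EqOn (f m) (f n) (Ioo (-(m + 1 : ℝ)) (m + 1)) := by
    intro m n hmn
    have hmn' : (m : ℝ) ≤ n := by exact_mod_cast hmn
    have hm : (0 : ℝ) ≤ m := m.cast_nonneg
    refine ODE_solution_unique_of_mem_Ioo (v := fun _ ↦ F) (s := fun _ ↦ univ) (K := K) (t₀ := 0)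
      (fun _ _ ↦ hF.lipschitzOnWith) ⟨by linarith, by linarith⟩ (fun t ht ↦ ⟨hf m t ht, mem_univ _⟩)
      (fun t ht ↦ ⟨hf n t ⟨by linarith [ht.1], by linarith [ht.2]⟩, mem_univ _⟩) ?_
    rw [hf₀, hf₀]
  -- The extra 1 puts t strictly inside its interval, so near t the glued curve coincides with a
  -- single local solution.
  have hceil : ∀ t : ℝ, t ∈ Ioo (-((⌈|t|⌉₊ : ℝ) + 1)) (⌈|t|⌉₊ + 1) := fun t ↦ by
    have := Nat.le_ceil |t|
    exact abs_lt.1 (by linarith)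
  refine ⟨fun t ↦ f ⌈|t|⌉₊ t, by simp [hf₀], fun t ↦ ?_⟩
  refine (hf _ t (hceil t)).congr_of_eventuallyEq ?_
  filter_upwards [Ioo_mem_nhds (hceil t).1 (hceil t).2] with s hs
  rcases le_total ⌈|s|⌉₊ ⌈|t|⌉₊ with h | h
  · exact agree _ _ h (hceil s)
  · exact (agree _ _ h hs).symm

theorem IsTrajectoryOn.mono {b : ℂ → ℝ} {U : Set ℂ} {T T' : ℝ} {q v : ℝ → ℂ}
    (h : IsTrajectoryOn b U T q v) (hT : T' ≤ T) : IsTrajectoryOn b U T' q v where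
  mem t ht := h.mem t ⟨ht.1, ht.2.trans hT⟩
  velocity t ht := (h.velocity t ⟨ht.1, ht.2.trans hT⟩).mono (Icc_subset_Icc_right hT)
  newton t ht := (h.newton t ⟨ht.1, ht.2.trans hT⟩).mono (Icc_subset_Icc_right hT)

/-- Newton's equation with a locally Lipschitz field has at most one solution with given
initial data. -/
theorem IsTrajectoryOn.unique {b : ℂ → ℝ} {U : Set ℂ} (hb : LocallyLipschitzOn U b) {T : ℝ}
    {q v q' v' : ℝ → ℂ} (h : IsTrajectoryOn b U T q v) (h' : IsTrajectoryOn b U T q' v')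
    (hq : q' 0 = q 0) (hv : v' 0 = v 0) :
    ∀ t ∈ Icc 0 T, q' t = q t ∧ v' t = v t := by
  have cq : ContinuousOn q (Icc 0 T) := fun t ht ↦ (h.velocity t ht).continuousWithinAt
  have cv : ContinuousOn v (Icc 0 T) := fun t ht ↦ (h.newton t ht).continuousWithinAt
  have cq' : ContinuousOn q' (Icc 0 T) := fun t ht ↦ (h'.velocity t ht).continuousWithinAt
  have cv' : ContinuousOn v' (Icc 0 T) := fun t ht ↦ (h'.newton t ht).continuousWithinAt
  -- Both solutions stay in the compact set Kq × Kv, on which the field of Newton's equation is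
  -- Lipschitz although it need not be so globally.
  set Kq : Set ℂ := q '' Icc 0 T ∪ q' '' Icc 0 T with hKq
  set Kv : Set ℂ := v '' Icc 0 T ∪ v' '' Icc 0 T with hKv
  have hKqc : IsCompact Kq := (isCompact_Icc.image_of_continuousOn cq).union
    (isCompact_Icc.image_of_continuousOn cq')
  have hKvc : IsCompact Kv := (isCompact_Icc.image_of_continuousOn cv).union
    (isCompact_Icc.image_of_continuousOn cv')
  have hKqU : Kq ⊆ U := by
    rintro z (⟨t, ht, rfl⟩ | ⟨t, ht, rfl⟩)
    exacts [h.mem t ht, h'.mem t ht]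
  obtain ⟨L, hL⟩ := (hb.mono hKqU).exists_lipschitzOnWith_of_compact hKqc
  obtain ⟨M, hM⟩ := hKqc.exists_bound_of_continuousOn hL.continuousOn
  obtain ⟨R, hR⟩ := hKvc.exists_bound_of_continuousOn (f := id) continuousOn_id
  set F : ℂ × ℂ → ℂ × ℂ := fun x ↦ (x.2, -Complex.I * (b x.1 : ℂ) * x.2) with hF
  have hlip : LipschitzOnWith (1 + M.toNNReal + L * R.toNNReal) F (Kq ×ˢ Kv) := by
    refine LipschitzOnWith.of_dist_le_mul fun x hx y hy ↦ ?_
    have hM' := hM x.1 hx.1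
    have hR' : ‖y.2‖ ≤ R := hR y.2 hy.2
    have hM₀ : 0 ≤ M := (norm_nonneg _).trans hM'
    have hR₀ : 0 ≤ R := (norm_nonneg _).trans hR'
    have h₁ : dist x.1 y.1 ≤ dist x y := le_max_left _ _
    have h₂ : dist x.2 y.2 ≤ dist x y := le_max_right _ _
    have hd := dist_nonneg (x := x) (y := y)
    have hbL : ‖b x.1 - b y.1‖ ≤ L * dist x y :=
      (hL.norm_sub_le hx.1 hy.1).trans (by rw [← dist_eq_norm]; gcongr)
    push_cast
    rw [Real.coe_toNNReal _ hM₀, Real.coe_toNNReal _ hR₀]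
    refine max_le ?_ ?_
    · have : 0 ≤ (M + L * R) * dist x y := by positivity
      simp only [hF]
      linarith
    · have : (F x).2 - (F y).2 = -Complex.I * ((b x.1 : ℂ) * (x.2 - y.2)
          + ((b x.1 - b y.1 : ℝ) : ℂ) * y.2) := by
        simp only [hF]; push_cast; ring
      rw [dist_eq_norm, this, norm_mul, norm_neg, Complex.norm_I, one_mul]
      refine (norm_add_le _ _).trans ?_
      rw [norm_mul, norm_mul, Complex.norm_real, Complex.norm_real, ← dist_eq_norm]
      have a₁ : ‖b x.1‖ * dist x.2 y.2 ≤ M * dist x y := by gcongr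
      have a₂ : ‖b x.1 - b y.1‖ * ‖y.2‖ ≤ (L * dist x y) * R := by gcongr
      nlinarith
  have hIci : ∀ t ∈ Ico 0 T, Icc 0 T ∈ 𝓝[≥] t := fun t ht ↦
    mem_of_superset (Icc_mem_nhdsGE ht.2) (Icc_subset_Icc_left ht.1)
  have := ODE_solution_unique_of_mem_Icc_right (v := fun _ ↦ F) (s := fun _ ↦ Kq ×ˢ Kv)
    (f := fun t ↦ (q' t, v' t)) (g := fun t ↦ (q t, v t)) (a := 0) (b := T)
    (fun _ _ ↦ hlip) (cq'.prodMk cv')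
    (fun t ht ↦ ((h'.velocity t (Ico_subset_Icc_self ht)).prodMk
      (h'.newton t (Ico_subset_Icc_self ht))).mono_of_mem_nhdsWithin (hIci t ht))
    (fun t ht ↦ ⟨Or.inr ⟨t, Ico_subset_Icc_self ht, rfl⟩, Or.inr ⟨t, Ico_subset_Icc_self ht, rfl⟩⟩)
    (cq.prodMk cv)
    (fun t ht ↦ ((h.velocity t (Ico_subset_Icc_self ht)).prodMk
      (h.newton t (Ico_subset_Icc_self ht))).mono_of_mem_nhdsWithin (hIci t ht))
    (fun t ht ↦ ⟨Or.inl ⟨t, Ico_subset_Icc_self ht, rfl⟩, Or.inl ⟨t, Ico_subset_Icc_self ht, rfl⟩⟩)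
    (by simp [hq, hv])
  exact fun t ht ↦ by simpa using this ht

/-! ### The one-dimensional radial fall. -/

/-- If `f` and its derivative both converge at infinity, the derivative tends to `0`. -/
theorem eq_zero_of_tendsto_of_tendsto_deriv {f f' : ℝ → ℝ} {c L : ℝ}
    (hf : ∀ t, HasDerivAt f (f' t) t) (hc : Tendsto f atTop (𝓝 c))
    (hL : Tendsto f' atTop (𝓝 L)) : L = 0 := by
  have hmv : ∀ t : ℝ, ∃ ξ ∈ Ioo t (t + 1), f' ξ = f (t + 1) - f t := by
    intro t
    obtain ⟨ξ, hξ, h⟩ := exists_hasDerivAt_eq_slope f f' (lt_add_one t)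
      (fun s _ ↦ (hf s).continuousAt.continuousWithinAt) (fun s _ ↦ hf s)
    exact ⟨ξ, hξ, by simpa using h⟩
  choose ξ hξ hξ' using hmv
  have hξt : Tendsto ξ atTop atTop := tendsto_atTop_mono (fun t ↦ (hξ t).1.le) tendsto_id
  have h₁ : Tendsto (fun t ↦ f (t + 1) - f t) atTop (𝓝 (c - c)) :=
    (hc.comp (tendsto_atTop_add_const_right _ 1 tendsto_id)).sub hc
  have h₂ : Tendsto (fun t ↦ f (t + 1) - f t) atTop (𝓝 L) := by
    simpa [Function.comp_def, hξ'] using hL.comp hξt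
  simpa using tendsto_nhds_unique h₂ h₁

/-- One-dimensional fall: with `u' = 2 w`, `w' = D(u)` and `w² = P(u)`, a motion that starts
inward from `u = 1` reaches the nearest zero `a` of `P` in finite time, provided `D(a) > 0`. -/
theorem exists_fall_time {u w P D : ℝ → ℝ} {a : ℝ} (hu : ∀ t, HasDerivAt u (2 * w t) t)
    (hw : ∀ t, HasDerivAt w (D (u t)) t) (hP : ∀ t, w t ^ 2 = P (u t)) (cP : Continuous P)
    (cD : Continuous D) (hu₀ : u 0 = 1) (ha : a < 1) (hPa : P a = 0) (hDa : 0 < D a)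
    (hne : ∀ x ∈ Ioo a 1, P x ≠ 0) (hin : w 0 < 0 ∨ w 0 = 0 ∧ D 1 < 0) :
    ∃ τ, 0 < τ ∧ u τ = a ∧ w τ = 0 ∧ (∀ t ∈ Ioo 0 τ, w t < 0) ∧ StrictAntiOn u (Icc 0 τ) := by
  have cu : Continuous u := continuous_iff_continuousAt.2 fun t ↦ (hu t).continuousAt
  have cw : Continuous w := continuous_iff_continuousAt.2 fun t ↦ (hw t).continuousAt
  have anti : ∀ τ, (∀ t ∈ Ioo 0 τ, w t < 0) → StrictAntiOn u (Icc 0 τ) := fun τ h ↦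
    strictAntiOn_of_deriv_neg (convex_Icc 0 τ) cu.continuousOn fun t ht ↦ by
      rw [interior_Icc] at ht
      rw [(hu t).deriv]
      linarith [h t ht]
  -- Crossing the level a would force w² = P(a) = 0 while w is still negative.
  have lower : ∀ τ, 0 < τ → (∀ t ∈ Ioo 0 τ, w t < 0) → a ≤ u τ := by
    intro τ hτ h
    by_contra! hlt
    obtain ⟨t, ht, hta⟩ := intermediate_value_Ioo' hτ.le cu.continuousOn
      (show a ∈ Ioo (u τ) (u 0) from ⟨hlt, by rwa [hu₀]⟩)
    have := hP t
    rw [hta, hPa] at this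
    exact (h t ht).ne (pow_eq_zero_iff two_ne_zero |>.1 this)
  have start : ∃ ε > 0, ∀ t ∈ Ioo 0 ε, w t < 0 := by
    have hev : ∀ᶠ t in 𝓝[>] (0 : ℝ), w t < 0 := by
      rcases hin with h | ⟨h, h'⟩
      · exact (cw.continuousAt.eventually_lt continuousAt_const h).filter_mono nhdsWithin_le_nhds
      · have hd : ∀ᶠ t in 𝓝 (0 : ℝ), D (u t) < 0 :=
          (cD.comp cu).continuousAt.eventually_lt continuousAt_const (by simpa [hu₀] using h')
        obtain ⟨ε, hε, hball⟩ := Metric.eventually_nhds_iff_ball.1 hd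
        have : StrictAntiOn w (Ico 0 ε) := strictAntiOn_of_deriv_neg (convex_Ico 0 ε)
          cw.continuousOn fun t ht ↦ by
            rw [interior_Ico] at ht
            rw [(hw t).deriv]
            exact hball t (by simp [abs_of_pos ht.1, ht.2])
        filter_upwards [Ioo_mem_nhdsGT hε] with t ht
        have := this (left_mem_Ico.2 hε) (Ioo_subset_Ico_self ht) ht.1
        linarith
    obtain ⟨ε, hε, h⟩ := mem_nhdsGT_iff_exists_Ioo_subset.1 hev
    exact ⟨ε, hε, fun t ht ↦ h ht⟩
  obtain ⟨ε, hε, hstart⟩ := start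
  -- If the fall never ended, u would converge to some c ≥ a and w to −√P(c). As u' and then w' must
  -- tend to 0, this gives P(c) = 0, hence c = a, and D(a) = 0.
  have hex : ∃ t, 0 < t ∧ 0 ≤ w t := by
    by_contra! hneg
    have hIoo : ∀ τ, ∀ t ∈ Ioo 0 τ, w t < 0 := fun τ t ht ↦ hneg t ht.1
    have hanti : ∀ s t, 0 ≤ s → s < t → u t < u s := fun s t hs hst ↦
      anti t (hIoo t) ⟨hs, hst.le⟩ ⟨hs.trans hst.le, le_rfl⟩ hst
    obtain ⟨c, hc⟩ : ∃ c, Tendsto u atTop (𝓝 c) := by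
      have hmono : Antitone fun t ↦ u (max t 0) := fun s t hst ↦ by
        rcases (max_le_max_right 0 hst).lt_or_eq with h | h
        · exact (hanti _ _ (le_max_right _ _) h).le
        · exact (congrArg u h).ge
      have hbdd : BddBelow (range fun t ↦ u (max t 0)) := ⟨a, by
        rintro _ ⟨t, rfl⟩
        rcases (le_max_right t 0).lt_or_eq with h | h
        · exact lower _ h (hIoo _)
        · simp only [← h, hu₀]; exact ha.le⟩
      refine ⟨_, (tendsto_atTop_ciInf hmono hbdd).congr' ?_⟩
      filter_upwards [eventually_ge_atTop 0] with t ht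
      rw [max_eq_left ht]
    have hca : a ≤ c := ge_of_tendsto hc <| by
      filter_upwards [eventually_gt_atTop 0] with t ht using lower t ht (hIoo t)
    have hc1 : c < 1 := by
      have : c ≤ u 1 := le_of_tendsto hc <| by
        filter_upwards [eventually_gt_atTop 1] with t ht using (hanti 1 t zero_le_one ht).le
      have := hanti 0 1 le_rfl one_pos
      linarith
    have hwt : Tendsto w atTop (𝓝 (-√(P c))) := by
      refine (((cP.tendsto c).comp hc).sqrt.neg).congr' ?_
      filter_upwards [eventually_gt_atTop 0] with t ht
      rw [Function.comp_apply, ← hP, Real.sqrt_sq_eq_abs, abs_of_neg (hneg t ht), neg_neg]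
    have h₀ : 2 * -√(P c) = 0 :=
      eq_zero_of_tendsto_of_tendsto_deriv hu hc (hwt.const_mul 2)
    have hPc : P c = 0 := by
      have hnn : 0 ≤ P c := ge_of_tendsto ((cP.tendsto c).comp hc) <|
        Eventually.of_forall fun t ↦ by rw [Function.comp_apply, ← hP]; positivity
      exact (Real.sqrt_eq_zero hnn).1 (by linarith)
    have hc' : c = a := by
      by_contra hcne
      exact hne c ⟨lt_of_le_of_ne hca (Ne.symm hcne), hc1⟩ hPc
    have := eq_zero_of_tendsto_of_tendsto_deriv hw hwt ((cD.tendsto c).comp hc)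
    rw [hc'] at this
    exact hDa.ne' this
  -- The bound ε excludes t = 0, where w may vanish in the tangential case.
  set S : Set ℝ := {t | ε ≤ t ∧ 0 ≤ w t} with hS
  have hSne : S.Nonempty := by
    obtain ⟨t, ht, hwt⟩ := hex
    refine ⟨t, ?_, hwt⟩
    by_contra! hlt
    exact (hstart t ⟨ht, hlt⟩).not_ge hwt
  have hSb : BddBelow S := ⟨ε, fun t ht ↦ ht.1⟩
  have hScl : IsClosed S :=
    (isClosed_le continuous_const continuous_id).inter (isClosed_le continuous_const cw)
  set τ := sInf S with hτ
  have hτS : τ ∈ S := hScl.csInf_mem hSne hSb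
  have hτ₀ : 0 < τ := hε.trans_le hτS.1
  have hneg : ∀ t ∈ Ioo 0 τ, w t < 0 := by
    intro t ht
    by_contra! hwt
    rcases lt_or_ge t ε with h | h
    · exact (hstart t ⟨ht.1, h⟩).not_ge hwt
    · exact ht.2.not_ge (csInf_le hSb ⟨h, hwt⟩)
  have hwτ : w τ = 0 := by
    refine le_antisymm ?_ hτS.2
    refine le_of_tendsto (cw.continuousAt.tendsto.mono_left (nhdsWithin_le_nhds (s := Iio τ))) ?_
    filter_upwards [Ioo_mem_nhdsLT hτ₀] with t ht using (hneg t ht).le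
  refine ⟨τ, hτ₀, ?_, hwτ, hneg, anti τ hneg⟩
  have hlt : u τ < 1 := hu₀ ▸ anti τ hneg ⟨le_rfl, hτ₀.le⟩ ⟨hτ₀.le, le_rfl⟩ hτ₀
  by_contra hcne
  exact hne (u τ) ⟨lt_of_le_of_ne (lower τ hτ₀ hneg) (Ne.symm hcne), hlt⟩ (by rw [← hP, hwτ]; simp)

/-! ### Newton's equation in position and direction, and its reflection symmetry. -/

/-- Newton's equation at speed `s`, written for the position `q` and the direction `φ` of the
velocity `s e^{iφ}`. -/
structure IsPhaseSolution (β : ℂ → ℝ) (s : ℝ) (q : ℝ → ℂ) (φ : ℝ → ℝ) : Prop where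
  position : ∀ t, HasDerivAt q (s * Complex.exp (φ t * Complex.I)) t
  phase : ∀ t, HasDerivAt φ (-β (q t)) t

/-- The vector field of Newton's equation in the variables position and direction. -/
noncomputable def phaseField (β : ℂ → ℝ) (s : ℝ) (x : ℂ × ℝ) : ℂ × ℝ :=
  (s * Complex.exp (x.2 * Complex.I), -β x.1)

theorem norm_exp_ofReal_mul_I_sub_le (x y : ℝ) :
    ‖Complex.exp (x * Complex.I) - Complex.exp (y * Complex.I)‖ ≤ ‖x - y‖ := by
  have h : Complex.exp (x * Complex.I) - Complex.exp (y * Complex.I) =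
      Complex.exp (y * Complex.I) * (Complex.exp (Complex.I * ((x - y : ℝ) : ℂ)) - 1) := by
    rw [mul_sub, ← Complex.exp_add]
    push_cast
    ring_nf
  rw [h, norm_mul, Complex.norm_exp_ofReal_mul_I, one_mul]
  exact Real.norm_exp_I_mul_ofReal_sub_one_le

/-- This is the purpose of the direction variable: with the speed fixed, the field is globally
Lipschitz, whereas the product β(q) v is not controlled for unbounded v. -/
theorem lipschitzWith_phaseField {β : ℂ → ℝ} {K : ℝ≥0} (hβ : LipschitzWith K β) (s : ℝ) :
    LipschitzWith (max ‖s‖₊ K) (phaseField β s) := by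
  refine LipschitzWith.of_dist_le_mul fun x y ↦ ?_
  have h₁ : dist x.1 y.1 ≤ dist x y := le_max_left _ _
  have h₂ : dist x.2 y.2 ≤ dist x y := le_max_right _ _
  push_cast
  refine max_le ?_ ?_
  · rw [dist_eq_norm]
    simp only [phaseField]
    rw [← mul_sub, norm_mul, Complex.norm_real]
    exact mul_le_mul (le_max_left _ _) ((norm_exp_ofReal_mul_I_sub_le _ _).trans h₂)
      (norm_nonneg _) ((norm_nonneg _).trans (le_max_left _ _))
  · simp only [phaseField]
    rw [dist_neg_neg]
    exact (hβ.dist_le_mul _ _).trans (mul_le_mul (le_max_right _ _) h₁ dist_nonneg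
      (K.2.trans (le_max_right _ _)))

theorem exists_isPhaseSolution {β : ℂ → ℝ} {K M : ℝ≥0} (hβ : LipschitzWith K β)
    (hM : ∀ z, ‖β z‖ ≤ M) (s : ℝ) (q₀ : ℂ) (φ₀ : ℝ) :
    ∃ q φ, IsPhaseSolution β s q φ ∧ q 0 = q₀ ∧ φ 0 = φ₀ := by
  have hb : ∀ x, ‖phaseField β s x‖ ≤ (max ‖s‖₊ M : ℝ≥0) := fun x ↦ by
    push_cast
    refine max_le_max ?_ ?_
    · simp [phaseField, Complex.norm_exp_ofReal_mul_I]
    · simpa [phaseField] using hM x.1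
  obtain ⟨f, hf₀, hf⟩ := exists_global_solution (lipschitzWith_phaseField hβ s) hb (q₀, φ₀)
  refine ⟨fun t ↦ (f t).1, fun t ↦ (f t).2, ⟨fun t ↦ ?_, fun t ↦ ?_⟩, by simp [hf₀], by simp [hf₀]⟩
  · exact ((hasFDerivAt_fst (𝕜 := ℝ) (p := f t)).comp_hasDerivAt t (hf t))
  · exact ((hasFDerivAt_snd (𝕜 := ℝ) (p := f t)).comp_hasDerivAt t (hf t))

namespace IsPhaseSolution

variable {β : ℂ → ℝ} {s : ℝ} {q q' : ℝ → ℂ} {φ φ' : ℝ → ℝ}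

theorem unique {K : ℝ≥0} (hβ : LipschitzWith K β) (h : IsPhaseSolution β s q φ)
    (h' : IsPhaseSolution β s q' φ') {τ : ℝ} (hq : q τ = q' τ) (hφ : φ τ = φ' τ) (t : ℝ) :
    q t = q' t ∧ φ t = φ' t := by
  have : (fun t ↦ (q t, φ t)) = fun t ↦ (q' t, φ' t) :=
    ODE_solution_unique_univ (v := fun _ ↦ phaseField β s) (s := fun _ ↦ univ) (t₀ := τ)
      (fun _ ↦ (lipschitzWith_phaseField hβ s).lipschitzOnWith)
      (fun t ↦ ⟨(h.position t).prodMk (h.phase t), mem_univ _⟩)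
      (fun t ↦ ⟨(h'.position t).prodMk (h'.phase t), mem_univ _⟩) (by simp [hq, hφ])
  simpa using congrFun this t

/-- A motion in a radial field is symmetric about a time at which the velocity is orthogonal to
the position. -/
theorem reflection {K : ℝ≥0} (hβ : LipschitzWith K β) (hrad : ∀ z z', ‖z‖ = ‖z'‖ → β z = β z')
    (h : IsPhaseSolution β s q φ) {τ : ℝ}
    (hτ : (conj (q τ) * Complex.exp (φ τ * Complex.I)).re = 0) (t : ℝ) :
    q (2 * τ - t) = -(Complex.exp (2 * φ τ * Complex.I) * conj (q t)) ∧
      φ (2 * τ - t) = 2 * φ τ - φ t := by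
  have hsub : ∀ t : ℝ, HasDerivAt (fun t : ℝ ↦ 2 * τ - t) (-1) t := fun t ↦ by
    simpa using (hasDerivAt_id t).const_sub (2 * τ)
  have hconj : ∀ x : ℝ, conj (Complex.exp (x * Complex.I)) = Complex.exp (-(x * Complex.I)) :=
    fun x ↦ by rw [← Complex.exp_conj]; simp
  -- The map z ↦ −e^{2iφ(τ)} conj z is the reflection in the line orthogonal to v(τ). It reverses
  -- orientation, as time reversal does, so the two signs cancel in the magnetic force. It fixes
  -- q(τ), and uniqueness concludes.
  have h' : IsPhaseSolution β s
      (fun t ↦ -(Complex.exp (2 * φ τ * Complex.I) * conj (q (2 * τ - t))))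
      (fun t ↦ 2 * φ τ - φ (2 * τ - t)) := by
    refine ⟨fun t ↦ ?_, fun t ↦ ?_⟩
    · have h₁ := (h.position (2 * τ - t)).scomp t (hsub t)
      have h₂ := ((h₁.star).const_mul (Complex.exp (2 * φ τ * Complex.I))).neg
      refine h₂.congr_deriv ?_
      simp only [Complex.star_def, neg_smul, one_smul, map_neg, map_mul, Complex.conj_ofReal, hconj]
      rw [mul_neg, neg_neg, mul_left_comm, ← Complex.exp_add]
      push_cast
      ring_nf
    · refine (((h.phase (2 * τ - t)).comp t (hsub t)).const_sub (2 * φ τ)).congr_deriv ?_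
      rw [mul_neg, mul_one, neg_neg]
      congr 1
      refine hrad _ _ ?_
      have : ‖Complex.exp (2 * φ τ * Complex.I)‖ = 1 := by
        rw [← Complex.norm_exp_ofReal_mul_I (2 * φ τ)]; push_cast; rfl
      rw [norm_neg, norm_mul, this, one_mul, RCLike.norm_conj]
  have key := h'.unique hβ h (τ := τ) ?_ ?_ (2 * τ - t)
  · simp only [sub_sub_cancel] at key
    exact ⟨key.1.symm, key.2.symm⟩
  · have e : 2 * τ - τ = τ := by ring
    simp only [e]
    have h₀ : conj (q τ) * Complex.exp (φ τ * Complex.I)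
        = -(q τ * Complex.exp (-(φ τ * Complex.I))) := by
      have : conj (conj (q τ) * Complex.exp (φ τ * Complex.I))
          = -(conj (q τ) * Complex.exp (φ τ * Complex.I)) := by
        apply Complex.ext
        · rw [Complex.conj_re, Complex.neg_re, hτ, neg_zero]
        · rw [Complex.conj_im, Complex.neg_im]
      rw [map_mul, Complex.conj_conj, hconj] at this
      rw [this, neg_neg]
    have e₂ : Complex.exp (2 * φ τ * Complex.I)
        = Complex.exp (φ τ * Complex.I) * Complex.exp (φ τ * Complex.I) := by
      rw [← Complex.exp_add]; ring_nf
    have e₃ : Complex.exp (-(φ τ * Complex.I)) * Complex.exp (φ τ * Complex.I) = 1 := by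
      rw [← Complex.exp_add]; simp
    calc -(Complex.exp (2 * φ τ * Complex.I) * conj (q τ))
        = -(conj (q τ) * Complex.exp (φ τ * Complex.I)) * Complex.exp (φ τ * Complex.I) := by
          rw [e₂]; ring
      _ = q τ * (Complex.exp (-(φ τ * Complex.I)) * Complex.exp (φ τ * Complex.I)) := by
          rw [h₀]; ring
      _ = q τ := by rw [e₃, mul_one]
  · have e : 2 * τ - τ = τ := by ring
    simp only [e]
    ring

theorem newton (h : IsPhaseSolution β s q φ) (t : ℝ) :
    HasDerivAt (fun t ↦ (s : ℂ) * Complex.exp (φ t * Complex.I))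
      (-Complex.I * (β (q t) : ℂ) * (s * Complex.exp (φ t * Complex.I))) t := by
  refine ((((h.phase t).ofReal_comp).mul_const Complex.I).cexp.const_mul (s : ℂ)).congr_deriv ?_
  push_cast
  ring

end IsPhaseSolution

/-! ### Radial and angular quantities along a trajectory. -/

section Curve

variable {q v : ℝ → ℂ} {β : ℂ → ℝ}

/-- The real and imaginary parts of conj q · v are r r' and r² θ'; in this form they are
differentiable at the origin as well. -/
theorem hasDerivAt_conj_mul (hq : ∀ t, HasDerivAt q (v t) t)
    (hv : ∀ t, HasDerivAt v (-Complex.I * (β (q t) : ℂ) * v t) t) (t : ℝ) :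
    HasDerivAt (fun t ↦ conj (q t) * v t)
      (((‖v t‖ ^ 2 : ℝ) : ℂ) - Complex.I * (β (q t) : ℂ) * (conj (q t) * v t)) t := by
  refine ((hq t).star.mul (hv t)).congr_deriv ?_
  have : conj (v t) * v t = ((‖v t‖ ^ 2 : ℝ) : ℂ) := by
    rw [mul_comm, Complex.mul_conj, Complex.normSq_eq_norm_sq]
  simp only [Complex.star_def]
  rw [← this]
  ring

theorem hasDerivAt_re_conj_mul (hq : ∀ t, HasDerivAt q (v t) t)
    (hv : ∀ t, HasDerivAt v (-Complex.I * (β (q t) : ℂ) * v t) t) (t : ℝ) :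
    HasDerivAt (fun t ↦ (conj (q t) * v t).re)
      (‖v t‖ ^ 2 + β (q t) * (conj (q t) * v t).im) t := by
  refine (Complex.reCLM.hasFDerivAt.comp_hasDerivAt t (hasDerivAt_conj_mul hq hv t)).congr_deriv ?_
  simp only [Complex.reCLM_apply, Complex.sub_re, Complex.ofReal_re, mul_assoc, Complex.I_mul_re,
    Complex.im_ofReal_mul]
  ring

theorem hasDerivAt_im_conj_mul (hq : ∀ t, HasDerivAt q (v t) t)
    (hv : ∀ t, HasDerivAt v (-Complex.I * (β (q t) : ℂ) * v t) t) (t : ℝ) :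
    HasDerivAt (fun t ↦ (conj (q t) * v t).im) (-(β (q t) * (conj (q t) * v t).re)) t := by
  refine (Complex.imCLM.hasFDerivAt.comp_hasDerivAt t (hasDerivAt_conj_mul hq hv t)).congr_deriv ?_
  simp only [Complex.imCLM_apply, Complex.sub_im, Complex.ofReal_im, mul_assoc, Complex.I_mul_im,
    Complex.re_ofReal_mul]
  ring

theorem hasDerivAt_norm_sq (hq : ∀ t, HasDerivAt q (v t) t) (t : ℝ) :
    HasDerivAt (fun t ↦ ‖q t‖ ^ 2) (2 * (conj (q t) * v t).re) t := by
  refine (hq t).norm_sq.congr_deriv ?_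
  rw [Complex.inner, mul_comm (v t)]

theorem re_sq_add_im_sq_conj_mul (z y : ℂ) :
    (conj z * y).re ^ 2 + (conj z * y).im ^ 2 = ‖y‖ ^ 2 * ‖z‖ ^ 2 := by
  have : Complex.normSq (conj z * y) = ‖y‖ ^ 2 * ‖z‖ ^ 2 := by
    rw [Complex.normSq_eq_norm_sq, norm_mul, RCLike.norm_conj]; ring
  rw [← this, Complex.normSq_apply]
  ring

/-- The direction of the velocity, doubled, in terms of the angle `∫ κ` swept by the position,
where `κ` is the angular velocity; the formula persists when the curve reaches the origin. -/
theorem velocity_sq_eq (hq : ∀ t, HasDerivAt q (v t) t) (cv : Continuous v) {κ : ℝ → ℝ}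
    (cκ : Continuous κ) {τ s : ℝ} (hτ : 0 < τ) (hq₀ : ‖q 0‖ = 1) (hs : ∀ t, ‖v t‖ = s)
    (hne : ∀ t ∈ Ico 0 τ, q t ≠ 0)
    (hκ : ∀ t ∈ Ico 0 τ, (conj (q t) * v t).im = κ t * ‖q t‖ ^ 2) :
    v τ ^ 2 = q 0 ^ 2 * Complex.exp (2 * (∫ t in (0 : ℝ)..τ, κ t : ℝ) * Complex.I) *
      ((s ^ 2 - 2 * ((conj (q τ) * v τ).im * κ τ) : ℝ) +
        (2 * ((conj (q τ) * v τ).re * κ τ) : ℝ) * Complex.I) := by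
  have cq : Continuous q := continuous_iff_continuousAt.2 fun t ↦ (hq t).continuousAt
  have hΘ : ∀ t, HasDerivAt (fun t ↦ ∫ x in (0 : ℝ)..t, κ x) (κ t) t := fun t ↦
    intervalIntegral.integral_hasDerivAt_right (cκ.intervalIntegrable _ _)
      cκ.aestronglyMeasurable.stronglyMeasurableAtFilter cκ.continuousAt
  set Θ : ℝ → ℝ := fun t ↦ ∫ x in (0 : ℝ)..t, κ x with hΘdef
  have cΘ : Continuous Θ := continuous_iff_continuousAt.2 fun t ↦ (hΘ t).continuousAt
  have hnq : ∀ t, conj (q t) * q t = ((‖q t‖ ^ 2 : ℝ) : ℂ) := fun t ↦ by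
    rw [mul_comm, Complex.mul_conj, Complex.normSq_eq_norm_sq]
  -- The quotient q / conj q is e^{2iθ}: doubling the polar angle θ avoids any choice of a branch of
  -- the argument.
  set f : ℝ → ℂ := fun t ↦ q t / conj (q t) * Complex.exp (-(2 * (Θ t : ℂ) * Complex.I)) with hf
  have hfd : ∀ t ∈ Ico 0 τ, HasDerivAt f 0 t := by
    intro t ht
    have hc : conj (q t) ≠ 0 := by simpa using hne t ht
    have h₁ : HasDerivAt (fun t ↦ q t / conj (q t))
        ((v t * conj (q t) - q t * conj (v t)) / conj (q t) ^ 2) t := (hq t).div (hq t).star hc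
    have h₂ : HasDerivAt (fun t ↦ Complex.exp (-(2 * (Θ t : ℂ) * Complex.I)))
        (Complex.exp (-(2 * (Θ t : ℂ) * Complex.I)) * -(2 * (κ t : ℂ) * Complex.I)) t :=
      ((((hΘ t).ofReal_comp).const_mul 2).mul_const Complex.I).neg.cexp
    refine (h₁.mul h₂).congr_deriv ?_
    have h₃ : v t * conj (q t) - q t * conj (v t)
        = 2 * ((κ t : ℂ) * (conj (q t) * q t)) * Complex.I := by
      have : q t * conj (v t) = conj (conj (q t) * v t) := by simp
      rw [hnq, this, mul_comm (v t), Complex.sub_conj, hκ t ht]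
      push_cast
      ring
    rw [h₃]
    field_simp
    ring
  have hconst : ∀ t ∈ Ico 0 τ, q t = conj (q t) * (q 0 ^ 2 * Complex.exp (2 * Θ t * Complex.I)) := by
    intro t ht
    have hc : conj (q t) ≠ 0 := by simpa using hne t ht
    have hsub : ∀ x ∈ Icc 0 t, x ∈ Ico 0 τ := fun x hx ↦ ⟨hx.1, hx.2.trans_lt ht.2⟩
    have h₁ := constant_of_has_deriv_right_zero (f := f) (a := 0) (b := t)
      (fun x hx ↦ (hfd x (hsub x hx)).continuousAt.continuousWithinAt)
      (fun x hx ↦ (hfd x (hsub x (Ico_subset_Icc_self hx))).hasDerivWithinAt) t ⟨ht.1, le_rfl⟩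
    have h₂ : f 0 = q 0 ^ 2 := by
      have hc₀ : conj (q 0) ≠ 0 := by simpa using hne 0 ⟨le_rfl, hτ⟩
      have := hnq 0
      rw [hq₀] at this
      simp only [hf, hΘdef, intervalIntegral.integral_same]
      simp only [Complex.ofReal_zero, mul_zero, zero_mul, neg_zero, Complex.exp_zero, mul_one]
      rw [div_eq_iff hc₀, sq, mul_assoc, mul_comm (q 0) (conj _), this]
      simp
    rw [h₂] at h₁
    rw [← h₁]
    simp only [hf]
    rw [mul_assoc, ← Complex.exp_add, neg_add_cancel, Complex.exp_zero, mul_one]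
    field_simp
  set g : ℝ → ℂ := fun t ↦ q 0 ^ 2 * Complex.exp (2 * (Θ t : ℂ) * Complex.I) *
      ((s ^ 2 - 2 * ((conj (q t) * v t).im * κ t) : ℝ) +
        (2 * ((conj (q t) * v t).re * κ t) : ℝ) * Complex.I) with hg
  -- From v² ‖q‖² = (w + i l)² · q / conj q, with w² + l² = s²‖q‖² and l = κ‖q‖², a factor ‖q‖²
  -- cancels. What remains is continuous up to τ even if q(τ) = 0.
  have heq : ∀ t ∈ Ico 0 τ, v t ^ 2 = g t := by
    intro t ht
    have hu : ((‖q t‖ ^ 2 : ℝ) : ℂ) ≠ 0 := by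
      have := norm_pos_iff.2 (hne t ht)
      exact_mod_cast (pow_pos this 2).ne'
    refine mul_right_cancel₀ hu ?_
    have h₁ : v t ^ 2 * ((‖q t‖ ^ 2 : ℝ) : ℂ) = (conj (q t) * v t) ^ 2 *
        (q 0 ^ 2 * Complex.exp (2 * Θ t * Complex.I)) := by
      rw [← hnq]
      nth_rw 2 [hconst t ht]
      ring
    have h₂ : (conj (q t) * v t) ^ 2 = ((s ^ 2 - 2 * ((conj (q t) * v t).im * κ t) : ℝ) +
        (2 * ((conj (q t) * v t).re * κ t) : ℝ) * Complex.I) * ((‖q t‖ ^ 2 : ℝ) : ℂ) := by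
      have e₁ := re_sq_add_im_sq_conj_mul (q t) (v t)
      have e₂ := hκ t ht
      rw [hs] at e₁
      set m := conj (q t) * v t
      apply Complex.ext
      · simp only [sq, Complex.mul_re, Complex.add_re, Complex.add_im, Complex.mul_im,
          Complex.ofReal_re, Complex.ofReal_im, Complex.I_re, Complex.I_im] at *
        linear_combination e₁ - 2 * m.im * e₂
      · simp only [sq, Complex.mul_re, Complex.add_re, Complex.add_im, Complex.mul_im,
          Complex.ofReal_re, Complex.ofReal_im, Complex.I_re, Complex.I_im] at *
        linear_combination 2 * m.re * e₂
    rw [h₁, h₂, hg]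
    ring
  have cg : Continuous g := by
    simp only [hg]
    fun_prop
  have h₁ : Tendsto (fun t ↦ v t ^ 2) (𝓝[<] τ) (𝓝 (v τ ^ 2)) :=
    ((cv.pow 2).tendsto τ).mono_left nhdsWithin_le_nhds
  have h₂ : Tendsto (fun t ↦ v t ^ 2) (𝓝[<] τ) (𝓝 (g τ)) := by
    refine ((cg.tendsto τ).mono_left nhdsWithin_le_nhds).congr' ?_
    filter_upwards [Ioo_mem_nhdsLT hτ] with t ht using (heq t (Ioo_subset_Ico_self ht)).symm
  exact tendsto_nhds_unique h₁ h₂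

end Curve

/-! ### From time to radius. -/

/-- Time parametrised by the radius `r = √u` of a falling motion. -/
theorem integral_radius_eq_integral_time {u w κ f : ℝ → ℝ} {τ a : ℝ} (hτ : 0 < τ)
    (hu : ∀ t, HasDerivAt u (2 * w t) t) (hanti : StrictAntiOn u (Icc 0 τ)) (hu₀ : u 0 = 1)
    (huτ : u τ = a) (ha : 0 ≤ a) (cκ : Continuous κ) (hw : ∀ t ∈ Ioo 0 τ, w t < 0)
    (hf : ∀ t ∈ Ioo 0 τ, -(w t / √(u t)) * f √(u t) = κ t) :
    IntervalIntegrable f volume √a 1 ∧ ∫ r in √a..1, f r = ∫ t in (0 : ℝ)..τ, κ t := by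
  have cu : Continuous u := continuous_iff_continuousAt.2 fun t ↦ (hu t).continuousAt
  have hlo : ∀ t ∈ Ico 0 τ, a < u t := fun t ht ↦
    huτ ▸ hanti (Ico_subset_Icc_self ht) ⟨hτ.le, le_rfl⟩ ht.2
  have hsanti : StrictAntiOn (fun t ↦ √(u t)) (Icc 0 τ) := fun x hx y hy hxy ↦ by
    refine Real.sqrt_lt_sqrt ?_ (hanti hx hy hxy)
    rcases hy.2.lt_or_eq with h | h
    · exact ha.trans (hlo y ⟨hy.1, h⟩).le
    · rw [h, huτ]; exact ha
  have himage : (fun t ↦ √(u t)) '' Ioo 0 τ = Ioo √a 1 := by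
    apply Subset.antisymm
    · rintro _ ⟨t, ht, rfl⟩
      constructor
      · rw [← huτ]; exact hsanti (Ioo_subset_Icc_self ht) ⟨hτ.le, le_rfl⟩ ht.2
      · have := hsanti ⟨le_rfl, hτ.le⟩ (Ioo_subset_Icc_self ht) ht.1
        simpa [hu₀] using this
    · have := intermediate_value_Ioo' hτ.le (f := fun t ↦ √(u t)) cu.sqrt.continuousOn
      simpa [hu₀, huτ] using this
  have hder : ∀ t ∈ Ioo 0 τ, HasDerivWithinAt (fun t ↦ √(u t)) (w t / √(u t)) (Ioo 0 τ) t := by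
    intro t ht
    have hpos : 0 < u t := ha.trans_lt (hlo t (Ioo_subset_Ico_self ht))
    refine ((hu t).sqrt hpos.ne').hasDerivWithinAt.congr_deriv ?_
    field_simp
  have hinj : InjOn (fun t ↦ √(u t)) (Ioo 0 τ) := hsanti.injOn.mono Ioo_subset_Icc_self
  have habs : ∀ t ∈ Ioo 0 τ, |w t / √(u t)| • f √(u t) = κ t := by
    intro t ht
    rw [abs_of_nonpos (div_nonpos_of_nonpos_of_nonneg (hw t ht).le (Real.sqrt_nonneg _)),
      smul_eq_mul, hf t ht]
  have ha1 : √a ≤ 1 := by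
    have := hsanti ⟨le_rfl, hτ.le⟩ ⟨hτ.le, le_rfl⟩ hτ
    simp only [hu₀, huτ, Real.sqrt_one] at this
    exact this.le
  constructor
  · rw [intervalIntegrable_iff_integrableOn_Ioo_of_le ha1, ← himage,
      integrableOn_image_iff_integrableOn_abs_deriv_smul measurableSet_Ioo hder hinj,
      integrableOn_congr_fun habs measurableSet_Ioo]
    exact (cκ.integrableOn_Icc).mono_set Ioo_subset_Icc_self
  · rw [intervalIntegral.integral_of_le ha1, intervalIntegral.integral_of_le hτ.le,
      integral_Ioc_eq_integral_Ioo, integral_Ioc_eq_integral_Ioo, ← himage,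
      integral_image_eq_integral_abs_deriv_smul measurableSet_Ioo hder hinj]
    exact setIntegral_congr_fun measurableSet_Ioo habs

/-! ### Field, flux and radial energy in the squared radius. -/

/-- The radial field `B(‖z‖)` of the unit disc, extended to the plane by its boundary value. -/
noncomputable def radialExtension (B : ℝ → ℝ) (z : ℂ) : ℝ := B (min ‖z‖ 1)

/-- The flux function `G` in terms of the squared radius. -/
noncomputable def fluxSq (B : ℝ → ℝ) (x : ℝ) : ℝ := ∫ σ in (0 : ℝ)..x, B (min √σ 1) / 2

/-- The extension is b composed with the 1-Lipschitz map z ↦ min(‖z‖, 1) into the compact disc. -/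
theorem exists_lipschitzWith_radialExtension {B : ℝ → ℝ} {b : ℂ → ℝ}
    (hb : LocallyLipschitzOn (Metric.closedBall (0 : ℂ) 1) b)
    (hrad : ∀ z ∈ Metric.closedBall (0 : ℂ) 1, b z = B ‖z‖) :
    ∃ K M : ℝ≥0, LipschitzWith K (radialExtension B) ∧ ∀ z, ‖radialExtension B z‖ ≤ M := by
  obtain ⟨K, hK⟩ := hb.exists_lipschitzOnWith_of_compact (isCompact_closedBall 0 1)
  obtain ⟨M, hM⟩ := (isCompact_closedBall (0 : ℂ) 1).exists_bound_of_continuousOn hK.continuousOn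
  have hn : ∀ z : ℂ, ‖((min ‖z‖ 1 : ℝ) : ℂ)‖ = min ‖z‖ 1 := fun z ↦ by
    rw [Complex.norm_real, Real.norm_of_nonneg (le_min (norm_nonneg _) zero_le_one)]
  have hmem : ∀ z : ℂ, ((min ‖z‖ 1 : ℝ) : ℂ) ∈ Metric.closedBall (0 : ℂ) 1 := fun z ↦ by
    rw [mem_closedBall_zero_iff, hn]
    exact min_le_right _ _
  have heq : ∀ z, radialExtension B z = b ((min ‖z‖ 1 : ℝ) : ℂ) := fun z ↦ by
    rw [hrad _ (hmem z), hn, radialExtension]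
  refine ⟨K, M.toNNReal, LipschitzWith.of_dist_le_mul fun z z' ↦ ?_, fun z ↦ ?_⟩
  · rw [heq, heq]
    refine (hK.dist_le_mul _ (hmem z) _ (hmem z')).trans ?_
    gcongr
    rw [dist_eq_norm, ← Complex.ofReal_sub, Complex.norm_real, Real.norm_eq_abs, dist_eq_norm]
    exact (abs_min_sub_min_le_max _ _ _ _).trans
      (by simpa using abs_norm_sub_norm_le z z')
  · rw [heq]
    exact (hM _ (hmem z)).trans (Real.le_coe_toNNReal M)

theorem radialExtension_eq {B : ℝ → ℝ} {b : ℂ → ℝ}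
    (hrad : ∀ z ∈ Metric.closedBall (0 : ℂ) 1, b z = B ‖z‖) {z : ℂ} (hz : ‖z‖ ≤ 1) :
    radialExtension B z = b z := by
  rw [hrad z (by simpa using hz), radialExtension, min_eq_left hz]

theorem continuous_comp_min_sqrt {B : ℝ → ℝ} (hB : Continuous (radialExtension B)) :
    Continuous fun σ ↦ B (min √σ 1) := by
  have : (fun σ ↦ B (min √σ 1)) = fun σ : ℝ ↦ radialExtension B ((√σ : ℝ) : ℂ) := by
    funext σ
    rw [radialExtension, Complex.norm_real, Real.norm_of_nonneg (Real.sqrt_nonneg _)]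
  rw [this]
  exact hB.comp (Complex.continuous_ofReal.comp Real.continuous_sqrt)

/-- As `√σ = 0` for σ ≤ 0, the integrand is continuous on the whole line, and differentiability
includes x = 0, which the passage through the origin requires. -/
theorem hasDerivAt_fluxSq {B : ℝ → ℝ} (hB : Continuous (radialExtension B)) (x : ℝ) :
    HasDerivAt (fluxSq B) (B (min √x 1) / 2) x := by
  have c := (continuous_comp_min_sqrt hB).div_const 2
  exact intervalIntegral.integral_hasDerivAt_right (c.intervalIntegrable _ _)
      c.aestronglyMeasurable.stronglyMeasurableAtFilter c.continuousAt

theorem continuous_fluxSq {B : ℝ → ℝ} (hB : Continuous (radialExtension B)) :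
    Continuous (fluxSq B) :=
  continuous_iff_continuousAt.2 fun x ↦ (hasDerivAt_fluxSq hB x).continuousAt

theorem G_eq_fluxSq {B : ℝ → ℝ} (hB : Continuous (radialExtension B)) {r : ℝ}
    (hr : r ∈ Icc (0 : ℝ) 1) : G B r = fluxSq B (r ^ 2) := by
  have c := (continuous_comp_min_sqrt hB).div_const 2
  have h := intervalIntegral.integral_comp_mul_deriv (a := 0) (b := r) (f := fun τ : ℝ ↦ τ ^ 2)
    (f' := fun τ ↦ 2 * τ) (g := fun σ ↦ B (min √σ 1) / 2)
    (fun τ _ ↦ by simpa using hasDerivAt_pow 2 τ) (by fun_prop) c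
  simp only [ne_eq, OfNat.ofNat_ne_zero, not_false_eq_true, zero_pow] at h
  rw [fluxSq, ← h, G]
  refine intervalIntegral.integral_congr fun τ hτ ↦ ?_
  rw [uIcc_of_le hr.1] at hτ
  simp only [Function.comp_apply]
  rw [Real.sqrt_sq hτ.1, min_eq_left (hτ.2.trans hr.2)]
  ring

theorem conj_mul_ofReal_exp_re (z : ℂ) (s φ : ℝ) :
    (conj z * (s * Complex.exp (φ * Complex.I))).re
      = s * (conj z * Complex.exp (φ * Complex.I)).re := by
  rw [mul_left_comm, Complex.re_ofReal_mul]

/-- `P(x) = r² ṙ²` as a function of the squared radius `x = r²`, at angular momentum `p` and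
speed `s`. -/
noncomputable def radialSq (B : ℝ → ℝ) (p s x : ℝ) : ℝ := s ^ 2 * x - (p - fluxSq B x) ^ 2

/-- The derivative of `radialSq`. -/
noncomputable def radialForce (B : ℝ → ℝ) (p s x : ℝ) : ℝ :=
  s ^ 2 + B (min √x 1) * (p - fluxSq B x)

theorem hasDerivAt_radialSq {B : ℝ → ℝ} (hB : Continuous (radialExtension B)) (p s x : ℝ) :
    HasDerivAt (radialSq B p s) (radialForce B p s x) x := by
  refine (((hasDerivAt_id x).const_mul (s ^ 2)).sub
    (((hasDerivAt_fluxSq hB x).const_sub p).pow 2)).congr_deriv ?_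
  rw [radialForce]
  push_cast
  ring

theorem angleIntegrand_eq {B : ℝ → ℝ} (hB : Continuous (radialExtension B)) (p s : ℝ) {x : ℝ}
    (hx : x ∈ Icc (0 : ℝ) 1) : angleIntegrand B p (s ^ 2 / 2) √x
      = (p - fluxSq B x) / (√x * √(radialSq B p s x)) := by
  rw [angleIntegrand, G_eq_fluxSq hB ⟨Real.sqrt_nonneg _, Real.sqrt_le_one.2 hx.2⟩,
    Real.sq_sqrt hx.1, radialSq]
  congr 4
  ring

/-! ### Escape from the disc and the exit velocity. -/

/-- A motion that enters the disc and whose radial motion has a nondegenerate turning point (or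
passage through the origin) at the squared radius `a`, nearest to the boundary, leaves the disc
in finite time; `k` is the angular velocity as a function of the squared radius. -/
theorem exists_escape {B : ℝ → ℝ} {b : ℂ → ℝ} {U : Set ℂ}
    (hdisc : Metric.closedBall (0 : ℂ) 1 ⊆ U) (hb : LocallyLipschitzOn U b)
    (hrad : ∀ z ∈ Metric.closedBall (0 : ℂ) 1, b z = B ‖z‖)
    {q₁ v₁ : ℂ} (hq₁ : ‖q₁‖ = 1) (hv₁ : v₁ ≠ 0)
    (henter : radialVelocity q₁ v₁ < 0 ∨
      (radialVelocity q₁ v₁ = 0 ∧ B 1 / tangentialVelocity q₁ v₁ < -1))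
    {p a : ℝ} (hp : p = angularMomentum B q₁ v₁) (ha₀ : 0 ≤ a) (ha₁ : a < 1)
    (hPa : radialSq B p ‖v₁‖ a = 0) (hDa : 0 < radialForce B p ‖v₁‖ a)
    (hne : ∀ x ∈ Ioo a 1, radialSq B p ‖v₁‖ x ≠ 0) {k : ℝ → ℝ} (ck : Continuous k)
    (hk : ∀ x, a ≤ x → p - fluxSq B x = k x * x) :
    ∃ (T : ℝ) (q v : ℝ → ℂ), IsTrajectoryOn b U T q v ∧ q 0 = q₁ ∧ v 0 = v₁ ∧
      EscapesAt q v T ∧ ‖v T‖ = ‖v₁‖ ∧ (∀ t ∈ Icc 0 T, a ≤ ‖q t‖ ^ 2) ∧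
      (∃ t ∈ Ioo 0 T, ‖q t‖ ^ 2 = a) ∧
      IntervalIntegrable (angleIntegrand B p (energy v₁)) volume √a 1 ∧
      conj v₁ * v T = (‖v₁‖ ^ 2 - 2 * ((p - fluxSq B a) * k a) : ℝ) *
        Complex.exp ((2 * (∫ r in √a..1, angleIntegrand B p (energy v₁) r)
          - 2 * orientedAngle q₁ v₁ : ℝ) * Complex.I) := by
  obtain ⟨K, M, hK, hM⟩ := exists_lipschitzWith_radialExtension (hb.mono hdisc) hrad
  have hB := hK.continuous
  set s := ‖v₁‖ with hs
  have hs₀ : 0 < s := norm_pos_iff.2 hv₁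
  obtain ⟨q, φ, hsol, hq₀, hφ₀⟩ := exists_isPhaseSolution hK hM s q₁ (Complex.arg v₁)
  set v : ℝ → ℂ := fun t ↦ s * Complex.exp (φ t * Complex.I) with hv
  have hv₀ : v 0 = v₁ := by
    simp only [hv, hφ₀, hs]
    exact Complex.norm_mul_exp_arg_mul_I v₁
  have hqd : ∀ t, HasDerivAt q (v t) t := hsol.position
  have hvd : ∀ t, HasDerivAt v (-Complex.I * (radialExtension B (q t) : ℂ) * v t) t := hsol.newton
  have cv : Continuous v := continuous_iff_continuousAt.2 fun t ↦ (hvd t).continuousAt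
  have hvs : ∀ t, ‖v t‖ = s := fun t ↦ by
    simp [hv, Complex.norm_exp_ofReal_mul_I, abs_of_pos hs₀]
  set u : ℝ → ℝ := fun t ↦ ‖q t‖ ^ 2 with hu
  set w : ℝ → ℝ := fun t ↦ (conj (q t) * v t).re with hw
  set l : ℝ → ℝ := fun t ↦ (conj (q t) * v t).im with hl
  have hud : ∀ t, HasDerivAt u (2 * w t) t := hasDerivAt_norm_sq hqd
  have hβu : ∀ t, radialExtension B (q t) = B (min √(u t) 1) := fun t ↦ by
    rw [radialExtension, hu, Real.sqrt_sq (norm_nonneg _)]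
  have hu₀ : u 0 = 1 := by simp [hu, hq₀, hq₁]
  have hl₀ : l 0 = p - fluxSq B 1 := by
    rw [hp, angularMomentum, hq₁, G_eq_fluxSq hB ⟨zero_le_one, le_rfl⟩, tangentialVelocity, hq₁]
    simp [hl, hq₀, hv₀]
  -- Conservation of the canonical angular momentum.
  have hlp : ∀ t, l t = p - fluxSq B (u t) := by
    have hd : ∀ t, HasDerivAt (fun t ↦ l t + fluxSq B (u t)) 0 t := fun t ↦ by
      refine ((hasDerivAt_im_conj_mul hqd hvd t).add
        ((hasDerivAt_fluxSq hB (u t)).comp t (hud t))).congr_deriv ?_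
      rw [hβu]
      ring
    intro t
    have := is_const_of_deriv_eq_zero (fun t ↦ (hd t).differentiableAt) (fun t ↦ (hd t).deriv) t 0
    simp only [hl₀, hu₀] at this
    linarith
  have hwd : ∀ t, HasDerivAt w (radialForce B p s (u t)) t := fun t ↦ by
    refine (hasDerivAt_re_conj_mul hqd hvd t).congr_deriv ?_
    rw [hvs, hβu, radialForce, ← hlp]
  have hwP : ∀ t, w t ^ 2 = radialSq B p s (u t) := fun t ↦ by
    have := re_sq_add_im_sq_conj_mul (q t) (v t)
    rw [hvs] at this
    rw [radialSq, ← hlp]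
    simp only [hw, hl, hu]
    linarith
  have cg := continuous_fluxSq hB
  have cP : Continuous (radialSq B p s) :=
    continuous_iff_continuousAt.2 fun x ↦ (hasDerivAt_radialSq hB p s x).continuousAt
  have cD : Continuous (radialForce B p s) :=
    continuous_const.add ((continuous_comp_min_sqrt hB).mul (continuous_const.sub cg))
  have hw₀ : radialVelocity q₁ v₁ = w 0 := by simp [radialVelocity, hq₁, hw, hq₀, hv₀]
  have hlt : tangentialVelocity q₁ v₁ = l 0 := by simp [tangentialVelocity, hq₁, hl, hq₀, hv₀]
  rw [hw₀, hlt] at henter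
  -- For tangential entry s² = l(0)², so D(1) = l(0)² (1 + B(1)/l(0)) < 0.
  have hin : w 0 < 0 ∨ w 0 = 0 ∧ radialForce B p s 1 < 0 := by
    refine henter.imp_right fun ⟨h₁, h₂⟩ ↦ ⟨h₁, ?_⟩
    have h₃ := hwP 0
    rw [h₁, radialSq, ← hlp, hu₀] at h₃
    have hl0 : l 0 ≠ 0 := fun h ↦ by rw [h, div_zero] at h₂; linarith
    have h₄ : B 1 * l 0 = B 1 / l 0 * l 0 ^ 2 := by field_simp
    rw [radialForce, ← hl₀, Real.sqrt_one, min_self, h₄]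
    have := pow_pos (abs_pos.2 hl0) 2
    rw [sq_abs] at this
    nlinarith
  have hw₀' : w 0 ≤ 0 := hin.elim le_of_lt fun h ↦ h.1.le
  obtain ⟨τ, hτ, huτ, hwτ, hneg, hanti⟩ :=
    exists_fall_time hud hwd hwP cP cD hu₀ ha₁ hPa hDa hne hin
  have hrefl := hsol.reflection hK (fun z z' h ↦ by simp [radialExtension, h]) (τ := τ) (by
    have := conj_mul_ofReal_exp_re (q τ) s (φ τ)
    have h' : (conj (q τ) * (s * Complex.exp (φ τ * Complex.I))).re = 0 := hwτ
    rw [h'] at this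
    exact (mul_eq_zero.1 this.symm).resolve_left hs₀.ne')
  set E := Complex.exp (2 * φ τ * Complex.I) with hE
  have hEn : ‖E‖ = 1 := by
    rw [hE, ← Complex.norm_exp_ofReal_mul_I (2 * φ τ)]; push_cast; rfl
  have husym : ∀ t, u (2 * τ - t) = u t := fun t ↦ by
    simp only [hu]
    rw [(hrefl t).1, norm_neg, norm_mul, hEn, one_mul, RCLike.norm_conj]
  have hvT : v (2 * τ) = E * conj v₁ := by
    have h := (hrefl 0).2
    rw [sub_zero] at h
    rw [← hv₀]
    simp only [hv]
    rw [h, map_mul, Complex.conj_ofReal, ← Complex.exp_conj, mul_left_comm, hE, ← Complex.exp_add,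
      map_mul, Complex.conj_ofReal, Complex.conj_I]
    push_cast
    ring_nf
  have hqT : q (2 * τ) = -(E * conj q₁) := by
    have h := (hrefl 0).1
    rwa [sub_zero, hq₀] at h
  have huI : ∀ t ∈ Icc 0 τ, a ≤ u t ∧ u t ≤ 1 := fun t ht ↦
    ⟨huτ ▸ hanti.antitoneOn ht ⟨hτ.le, le_rfl⟩ ht.2, hu₀ ▸ hanti.antitoneOn ⟨le_rfl, hτ.le⟩ ht ht.1⟩
  have huT : ∀ t ∈ Icc 0 (2 * τ), a ≤ u t ∧ u t ≤ 1 := fun t ht ↦ by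
    rcases le_total t τ with h | h
    · exact huI t ⟨ht.1, h⟩
    · rw [← husym]
      exact huI _ ⟨by linarith [ht.2], by linarith⟩
  have huT' : ∀ t ∈ Ioo 0 (2 * τ), u t < 1 := fun t ht ↦ by
    rcases le_total t τ with h | h
    · exact hu₀ ▸ hanti ⟨le_rfl, hτ.le⟩ ⟨ht.1.le, h⟩ ht.1
    · rw [← husym]
      exact hu₀ ▸ hanti ⟨le_rfl, hτ.le⟩ ⟨by linarith [ht.2], by linarith⟩ (by linarith [ht.2])
  have hnorm : ∀ t ∈ Icc 0 (2 * τ), ‖q t‖ ≤ 1 := fun t ht ↦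
    (sq_le_one_iff₀ (norm_nonneg _)).1 (huT t ht).2
  have ckt : Continuous fun t ↦ k (u t) :=
    ck.comp (continuous_iff_continuousAt.2 fun t ↦ (hud t).continuousAt)
  obtain ⟨hint, hval⟩ := integral_radius_eq_integral_time (f := angleIntegrand B p (energy v₁))
    hτ hud hanti hu₀ huτ ha₀ ckt hneg (fun t ht ↦ by
      have hut := huI t (Ioo_subset_Icc_self ht)
      have hut₀ : 0 < u t := ha₀.trans_lt
        (huτ ▸ hanti (Ioo_subset_Icc_self ht) ⟨hτ.le, le_rfl⟩ ht.2)
      have hsq : 0 < √(u t) := Real.sqrt_pos.2 hut₀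
      have hw' := (hneg t ht).ne
      rw [energy, angleIntegrand_eq hB p _ ⟨hut₀.le, hut.2⟩, ← hs, ← hwP, Real.sqrt_sq_eq_abs (w t),
        abs_of_neg (hneg t ht), hk _ hut.1]
      field_simp
      rw [Real.sq_sqrt hut₀.le, mul_comm])
  have hvsq := velocity_sq_eq hqd cv ckt hτ (by rw [hq₀, hq₁]) hvs
    (fun t ht h ↦ by
      have : a < u t := huτ ▸ hanti (Ico_subset_Icc_self ht) ⟨hτ.le, le_rfl⟩ ht.2
      rw [hu] at this
      simp only [h, norm_zero] at this
      linarith [show (0 : ℝ) ^ 2 = 0 by norm_num])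
    (fun t ht ↦ by
      have := hlp t
      rw [hk _ (huI t (Ico_subset_Icc_self ht)).1] at this
      exact this)
  have hlτ : (conj (q τ) * v τ).im = p - fluxSq B a := by rw [← huτ]; exact hlp τ
  have hwτ' : (conj (q τ) * v τ).re = 0 := hwτ
  rw [← hval, hlτ, hwτ', huτ, hq₀] at hvsq
  simp only [zero_mul, mul_zero, Complex.ofReal_zero, add_zero] at hvsq
  refine ⟨2 * τ, q, v, ⟨fun t ht ↦ hdisc (by simpa using hnorm t ht), fun t ht ↦
    (hqd t).hasDerivWithinAt, fun t ht ↦ ?_⟩, hq₀, hv₀, ⟨by linarith, fun t ht ↦ ?_, ?_, ?_⟩,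
    hvs _, fun t ht ↦ (huT t ht).1, ⟨τ, ⟨hτ, by linarith⟩, huτ⟩, hint, ?_⟩
  · rw [← radialExtension_eq hrad (hnorm t ht)]
    exact (hvd t).hasDerivWithinAt
  · exact (sq_lt_one_iff₀ (norm_nonneg _)).1 (huT' t ht)
  · rw [hqT, norm_neg, norm_mul, hEn, RCLike.norm_conj, hq₁, one_mul]
  · intro x hx
    have hT : ‖q (2 * τ)‖ = 1 := by
      rw [hqT, norm_neg, norm_mul, hEn, RCLike.norm_conj, hq₁, one_mul]
    -- The reflection reverses the radial velocity, so the exit is outward or tangential and the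
    -- norm grows along the half-line.
    have hwT : (conj (q (2 * τ)) * v (2 * τ)).re = -w 0 := by
      have h₁ : conj E * E = 1 := by
        rw [mul_comm, Complex.mul_conj, Complex.normSq_eq_norm_sq, hEn]; simp
      have h₂ : conj (q (2 * τ)) * v (2 * τ) = -conj (conj q₁ * v₁) := by
        rw [hqT, hvT]
        simp only [map_neg, map_mul, Complex.conj_conj]
        linear_combination (-(q₁ * conj v₁)) * h₁
      rw [h₂, Complex.neg_re, Complex.conj_re]
      simp only [hw, hq₀, hv₀]
    have hexp : ‖q (2 * τ) + x * v (2 * τ)‖ ^ 2 = 1 + 2 * (x * -w 0) + (x * s) ^ 2 := by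
      rw [norm_add_sq_real, hT, Complex.inner, norm_mul, hvs, Complex.norm_real,
        Real.norm_of_nonneg hx.le, ← hwT, mul_assoc, Complex.re_ofReal_mul,
        mul_comm (v (2 * τ))]
      ring
    have h₁ : 0 < (x * s) ^ 2 := by positivity
    have h₂ : 0 ≤ x * -w 0 := mul_nonneg hx.le (by linarith)
    have h₃ : 1 < ‖q (2 * τ) + x * v (2 * τ)‖ ^ 2 := by rw [hexp]; linarith
    exact (one_lt_sq_iff₀ (norm_nonneg _)).1 h₃
  · have hsC : (s : ℂ) ^ 2 ≠ 0 := by exact_mod_cast (pow_pos hs₀ 2).ne'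
    have hvE : v τ ^ 2 = s ^ 2 * E := by
      simp only [hv]
      rw [mul_pow, ← Complex.exp_nat_mul, hE]
      push_cast
      ring_nf
    have hγ : q₁ * conj v₁ = s * Complex.exp (-(orientedAngle q₁ v₁ * Complex.I)) := by
      have h₁ := Complex.norm_mul_exp_arg_mul_I (conj q₁ * v₁)
      rw [norm_mul, RCLike.norm_conj, hq₁, one_mul] at h₁
      have h₂ := congrArg conj h₁
      simp only [map_mul, Complex.conj_conj, Complex.conj_ofReal, ← Complex.exp_conj,
        Complex.conj_I] at h₂
      rw [← h₂, orientedAngle, mul_neg]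
    refine mul_left_cancel₀ hsC ?_
    set A := ∫ r in √a..1, angleIntegrand B p (energy v₁) r
    set C : ℂ := ((s ^ 2 - 2 * ((p - fluxSq B a) * k a) : ℝ) : ℂ)
    -- Here v(T) = E conj v₁ and v(τ)² = s²E, while q₁ conj v₁ = s e^{−iγ}; its square contributes
    -- s² and the angle −2γ.
    calc (s : ℂ) ^ 2 * (conj v₁ * v (2 * τ)) = conj v₁ ^ 2 * (s ^ 2 * E) := by rw [hvT]; ring
      _ = (q₁ * conj v₁) ^ 2 * Complex.exp (2 * A * Complex.I) * C := by
        rw [← hvE, hvsq]; ring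
      _ = (s : ℂ) ^ 2 * (C * (Complex.exp (2 * A * Complex.I) *
          Complex.exp (-(orientedAngle q₁ v₁ * Complex.I)) ^ 2)) := by rw [hγ]; ring
      _ = _ := by
        rw [← Complex.exp_nat_mul, ← Complex.exp_add]
        push_cast
        ring_nf

/-! ### Translation to the effective potential V. -/

theorem arg_ofReal_mul_exp_coe_angle {r : ℝ} (hr : 0 < r) (θ : ℝ) :
    (Complex.arg (r * Complex.exp (θ * Complex.I)) : Real.Angle) = θ := by
  rw [Complex.exp_mul_I]
  have := Complex.arg_mul_cos_add_sin_mul_I_coe_angle hr (θ : Real.Angle)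
  simpa using this

theorem V_eq_sub_radialSq {B : ℝ → ℝ} (hB : Continuous (radialExtension B)) (p s : ℝ) {r : ℝ}
    (hr : r ∈ Ioo (0 : ℝ) 1) :
    V B p r = s ^ 2 / 2 - radialSq B p s (r ^ 2) / (2 * r ^ 2) := by
  have := hr.1.ne'
  rw [V, G_eq_fluxSq hB (Ioo_subset_Icc_self hr), radialSq]
  field_simp
  ring

theorem V_eq_iff_radialSq_eq_zero {B : ℝ → ℝ} (hB : Continuous (radialExtension B)) (p s : ℝ)
    {r : ℝ} (hr : r ∈ Ioo (0 : ℝ) 1) : V B p r = s ^ 2 / 2 ↔ radialSq B p s (r ^ 2) = 0 := by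
  have := hr.1.ne'
  rw [V_eq_sub_radialSq hB p s hr, sub_eq_self, div_eq_zero_iff]
  simp [this]

/-- At a zero of P the derivative of the denominator does not contribute, so V' < 0 becomes the
condition D > 0 of the radial fall. -/
theorem deriv_V_of_radialSq_eq_zero {B : ℝ → ℝ} (hB : Continuous (radialExtension B)) (p s : ℝ)
    {r : ℝ} (hr : r ∈ Ioo (0 : ℝ) 1) (h₀ : radialSq B p s (r ^ 2) = 0) :
    deriv (V B p) r = -(radialForce B p s (r ^ 2) / r) := by
  have hr₀ := hr.1.ne'
  have hd : HasDerivAt (fun r ↦ r ^ 2) (2 * r) r := by simpa using hasDerivAt_pow 2 r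
  have h := (((hasDerivAt_radialSq hB p s (r ^ 2)).comp r hd).div (hd.const_mul 2)
    (by positivity)).const_sub (s ^ 2 / 2)
  have heq : V B p =ᶠ[𝓝 r]
      fun r ↦ s ^ 2 / 2 - (radialSq B p s ∘ fun r ↦ r ^ 2) r / (2 * r ^ 2) := by
    filter_upwards [Ioo_mem_nhds hr.1 hr.2] with x hx using V_eq_sub_radialSq hB p s hx
  rw [heq.deriv_eq]
  refine h.deriv.trans ?_
  rw [Function.comp_apply, h₀]
  field_simp
  ring

end MagneticScattering

/-! ### The two cases of the theorem. -/

open MagneticScattering in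
theorem theorem2p6
    -- the radial field, with a locally Lipschitz extension `b` around the closed unit disc
    (B : ℝ → ℝ) (b : ℂ → ℝ) (U : Set ℂ) (hU : IsOpen U)
    (hdisc : Metric.closedBall (0 : ℂ) 1 ⊆ U) (hb : LocallyLipschitzOn U b)
    (hrad : ∀ z ∈ Metric.closedBall (0 : ℂ) 1, b z = B ‖z‖)
    -- the initial data: on the unit circle, entering the disc
    (q₁ v₁ : ℂ) (hq₁ : ‖q₁‖ = 1) (hv₁ : v₁ ≠ 0)
    (henter : radialVelocity q₁ v₁ < 0 ∨
      (radialVelocity q₁ v₁ = 0 ∧ B 1 / tangentialVelocity q₁ v₁ < -1))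
    (p H₀ γ : ℝ) (hp : p = angularMomentum B q₁ v₁) (hH₀ : H₀ = energy v₁)
    (hγ : γ = orientedAngle q₁ v₁)
    (hV : (∃ rs, IsOutermostTurningPoint B p H₀ rs ∧ deriv (V B p) rs < 0) ∨
      (p = 0 ∧ ∀ r ∈ Set.Ioo (0 : ℝ) 1, V B p r ≠ H₀)) :
    ∃ (T : ℝ) (q v : ℝ → ℂ),
      -- the trajectory with these initial data, and its uniqueness
      IsTrajectoryOn b U T q v ∧ q 0 = q₁ ∧ v 0 = v₁ ∧
      (∀ (T' : ℝ) (q' v' : ℝ → ℂ), IsTrajectoryOn b U T' q' v' → q' 0 = q₁ → v' 0 = v₁ →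
        ∀ t ∈ Set.Icc 0 (min T T'), q' t = q t ∧ v' t = v t) ∧
      -- it escapes at the time `T`, with velocity `v T`
      EscapesAt q v T ∧ ‖v T‖ = ‖v₁‖ ∧
      -- the scattering angle, modulo `2π`
      ((∃ rs, IsOutermostTurningPoint B p H₀ rs ∧ deriv (V B p) rs < 0 ∧
          (∀ t ∈ Set.Icc 0 T, q t ≠ 0) ∧
          IntervalIntegrable (angleIntegrand B p H₀) MeasureTheory.volume rs 1 ∧
          (orientedAngle v₁ (v T) : Real.Angle) =
            ((2 * (∫ r in rs..1, angleIntegrand B p H₀ r) + Real.pi - 2 * γ : ℝ) : Real.Angle)) ∨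
        (p = 0 ∧ (∀ r ∈ Set.Ioo (0 : ℝ) 1, V B p r ≠ H₀) ∧
          (∃ t ∈ Set.Ioo 0 T, q t = 0) ∧
          IntervalIntegrable (angleIntegrand B 0 H₀) MeasureTheory.volume 0 1 ∧
          (orientedAngle v₁ (v T) : Real.Angle) =
            ((2 * (∫ r in (0 : ℝ)..1, angleIntegrand B 0 H₀ r) - 2 * γ : ℝ) : Real.Angle))) := by
  obtain ⟨K, M, hK, -⟩ := exists_lipschitzWith_radialExtension (hb.mono hdisc) hrad
  have hB := hK.continuous
  have cg := continuous_fluxSq hB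
  have hs : 0 < ‖v₁‖ ^ 2 := pow_pos (norm_pos_iff.2 hv₁) 2
  have hsq : ∀ x ∈ Ioo (0 : ℝ) 1, √x ∈ Ioo (0 : ℝ) 1 := fun x hx ↦
    ⟨Real.sqrt_pos.2 hx.1, (Real.sqrt_lt' one_pos).2 (by simpa using hx.2)⟩
  have huniq : ∀ {T : ℝ} {q v : ℝ → ℂ}, IsTrajectoryOn b U T q v → q 0 = q₁ → v 0 = v₁ →
      ∀ (T' : ℝ) (q' v' : ℝ → ℂ), IsTrajectoryOn b U T' q' v' → q' 0 = q₁ → v' 0 = v₁ →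
        ∀ t ∈ Icc 0 (min T T'), q' t = q t ∧ v' t = v t :=
    fun h hq hv T' q' v' h' hq' hv' ↦ (h.mono (min_le_left _ _)).unique hb
      (h'.mono (min_le_right _ _)) (hq'.trans hq.symm) (hv'.trans hv.symm)
  subst hH₀ hγ
  rcases hV with ⟨rs, hrs, hder⟩ | ⟨hp₀, hno⟩
  · have hr : rs ∈ Ioo (0 : ℝ) 1 := hrs.1.1
    have ha : 0 < rs ^ 2 := pow_pos hr.1 2
    have hP := (V_eq_iff_radialSq_eq_zero hB p ‖v₁‖ hr).1 hrs.1.2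
    have hD : 0 < radialForce B p ‖v₁‖ (rs ^ 2) := by
      rw [deriv_V_of_radialSq_eq_zero hB p ‖v₁‖ hr hP, neg_lt_zero] at hder
      exact (div_pos_iff_of_pos_right hr.1).1 hder
    obtain ⟨T, q, v, htraj, hq, hv, hesc, hnorm, hlow, -, hint, hangle⟩ :=
      exists_escape hdisc hb hrad hq₁ hv₁ henter hp ha.le
        (pow_lt_one₀ hr.1.le hr.2 two_ne_zero) hP hD
        (fun x hx hx₀ ↦ by
          have hx' : x ∈ Ioo (0 : ℝ) 1 := ⟨ha.trans hx.1, hx.2⟩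
          have hle := hrs.2 ⟨hsq x hx', (V_eq_iff_radialSq_eq_zero hB p ‖v₁‖ (hsq x hx')).2
            (by rwa [Real.sq_sqrt hx'.1.le])⟩
          exact hle.not_gt ((Real.lt_sqrt hr.1.le).2 hx.1))
        -- The maximum keeps the angular velocity continuous on all of ℝ without changing it for x ≥
        -- r*².
        (k := fun x ↦ (p - fluxSq B x) / max x (rs ^ 2))
        ((continuous_const.sub cg).div (continuous_id.max continuous_const)
          fun x ↦ (ha.trans_le (le_max_right _ _)).ne')
        (fun x hx ↦ by
          have : x ≠ 0 := (ha.trans_le hx).ne'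
          simp only [max_eq_left hx]
          field_simp)
    refine ⟨T, q, v, htraj, hq, hv, huniq htraj hq hv, hesc, hnorm, Or.inl ⟨rs, hrs, hder, ?_⟩⟩
    rw [Real.sqrt_sq hr.1.le] at hint hangle
    refine ⟨fun t ht h ↦ ?_, hint, ?_⟩
    · have := hlow t ht
      rw [h, norm_zero] at this
      linarith [show (0 : ℝ) ^ 2 = 0 by norm_num]
    -- P(r*²) = 0 says l² = s² r*², so s² − 2l²/r*² = −s²; the negative sign adds π to the argument.
    · have hC : ‖v₁‖ ^ 2 - 2 * ((p - fluxSq B (rs ^ 2)) *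
          ((p - fluxSq B (rs ^ 2)) / max (rs ^ 2) (rs ^ 2))) = -‖v₁‖ ^ 2 := by
        have hr₀ := hr.1.ne'
        rw [radialSq] at hP
        rw [max_self]
        field_simp
        linarith
      rw [hC] at hangle
      rw [orientedAngle, hangle, Complex.ofReal_neg, neg_mul, Complex.arg_neg_coe_angle
        (mul_ne_zero (by exact_mod_cast hs.ne') (Complex.exp_ne_zero _)),
        arg_ofReal_mul_exp_coe_angle hs, ← Real.Angle.coe_add]
      congr 1
      ring
  · subst hp₀
    have hg₀ : fluxSq B 0 = 0 := by simp [fluxSq]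
    have hdiff : Differentiable ℝ (fluxSq B) := fun x ↦ (hasDerivAt_fluxSq hB x).differentiableAt
    obtain ⟨T, q, v, htraj, hq, hv, hesc, hnorm, -, ⟨t, ht, hqt⟩, hint, hangle⟩ :=
      exists_escape hdisc hb hrad hq₁ hv₁ henter hp le_rfl one_pos
        (by simp [radialSq, hg₀]) (by simpa [radialForce, hg₀] using hs)
        (fun x hx hx₀ ↦ hno √x (hsq x hx) ((V_eq_iff_radialSq_eq_zero hB 0 ‖v₁‖ (hsq x hx)).2
            (by rwa [Real.sq_sqrt hx.1.le])))
        -- The angular velocity −g(x)/x, completed at 0 by −g'(0), is continuous through the origin.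
        (k := fun x ↦ -dslope (fluxSq B) 0 x)
        (by
          refine (continuousOn_univ.1 ?_).neg
          exact (continuousOn_dslope univ_mem).2 ⟨cg.continuousOn, hdiff 0⟩)
        (fun x _ ↦ by
          have := sub_smul_dslope (fluxSq B) 0 x
          rw [sub_zero, hg₀, sub_zero, smul_eq_mul] at this
          rw [← this]
          ring)
    refine ⟨T, q, v, htraj, hq, hv, huniq htraj hq hv, hesc, hnorm, Or.inr ⟨rfl, hno, ?_⟩⟩
    rw [Real.sqrt_zero] at hint hangle
    refine ⟨⟨t, ht, by simpa using hqt⟩, hint, ?_⟩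
    rw [hg₀, sub_zero, zero_mul, mul_zero, sub_zero] at hangle
    rw [orientedAngle, hangle, arg_ofReal_mul_exp_coe_angle hs]
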